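/- Theorem (Every 2-entropic matroid is binary). Let $M=(E,r)$ be a matroid with finite ground set $E$ and rank function $r$. Suppose that $M$ is 2-entropic, that is, there is a probability distribution $\mu$ on $\{0,1\}^E$ such that for every $S\subseteq E$, $$r(S)=H(\mu_S)=-\sum_{y\in\{0,1\}^S}\mu_S(y)\log_2\mu_S(y)\qquad(0\log_2 0=0),$$ where $\mu_S$ is the marginal of $\mu$ on the coordinates in $S$. Then $M$ is binary, that is, representable over $\mathbb{F}_2$: there are a vector space $V$ over $\mathbb{F}_2$ and a map $f:E\to V$ such that $r(S)=\dim\operatorname{span}f(S)$ for every $S\subseteq E$. -/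

import Mathlib

namespace EntropicMatroid

/-- The integer rank `r(X)` of a set `X` in a matroid. It is only used for finite `X`, where
`M.eRk X ≤ |X|` is finite. -/
noncomputable def rank {α : Type*} (M : Matroid α) (X : Set α) : ℕ := (M.eRk X).toNat

/-- The Shannon entropy in base `b` of a probability distribution on a finite set. Terms with
`μ x = 0` vanish, by the convention `0 * log 0 = 0`. -/
noncomputable def entropy {Ω : Type*} [Fintype Ω] (b : ℝ) (μ : PMF Ω) : ℝ :=
  -∑ x, (μ x).toReal * Real.logb b (μ x).toReal

/-- The marginal on the coordinates in `S` of a joint distribution `μ` of random variables indexed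
by `ι` with values in `κ`. -/
noncomputable def marginal {ι κ : Type*} (μ : PMF (ι → κ)) (S : Finset ι) : PMF (S → κ) :=
  μ.map (fun x (i : S) => x i)

open Classical in
/-- A (finite) matroid `M` with ground set `E` is `q`-entropic if there is a probability
distribution `μ` on `[q]^E` such that, for every subset `S` of the ground set, the rank of `S` is
the base-`q` Shannon entropy of the marginal of `μ` on `S`. -/
def IsEntropic {α : Type*} (q : ℕ) (M : Matroid α) : Prop :=
  ∃ μ : PMF (M.E → Fin q), ∀ S : Finset M.E,
    (rank M ((fun e : M.E => (e : α)) '' (S : Set M.E)) : ℝ) = entropy (q : ℝ) (marginal μ S)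

universe u

/-- A (finite) matroid `M` with ground set `E` is `F`-representable if there are a vector space `V`
over `F` and a map `f : E → V` such that, for every subset `S` of the ground set, the rank of `S`
is the dimension of the linear span of `f(S)`. Taking `V` in the universe of `F` is no restriction,
since `V` may be replaced by the finite-dimensional span of `f(E)`. -/
def IsRepresentable {α : Type*} (F : Type u) [Field F] (M : Matroid α) : Prop :=
  ∃ (V : Type u) (_ : AddCommGroup V) (_ : Module F V) (f : M.E → V), ∀ S : Finset M.E,
    rank M ((fun e : M.E => (e : α)) '' (S : Set M.E)) =
      Module.finrank F (Submodule.span F (f '' (S : Set M.E)))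

/-- A matroid is binary if it is representable over the field with two elements. -/
def IsBinary {α : Type*} (M : Matroid α) : Prop := IsRepresentable (ZMod 2) M

end EntropicMatroid

/-!
Let `μ` be a distribution on `{0,1}^E` whose entropies are the ranks of `M`, and let `A` be its
support. The ground element `e` is represented by the `e`-th coordinate function on `A`, taken
modulo constants (normalised to vanish at a point `x₀` of `A`).

* If `S` is independent then `H(μ_S) = |S|` is the largest possible entropy, so `μ_S` has full
  support (`mem_support_of_entropy_eq_logb_card`): the points of `A` take all values on `S`.
  Hence the coordinate functions of `S` are linearly independent modulo constants.
* If `C` is a circuit and `f ∈ C`, then `H(μ_C) = H(μ_{C - f})`, so on `A` the coordinate `f` is a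
  function of those in `C - f` (`injOn_support_of_entropy_map_eq`), while the points of `A` take all
  values on `C - f`. A function on `{0,1}^{C - f}` that changes whenever a single coordinate is
  flipped is the parity function up to a constant, so the coordinates in `C` have a constant sum on
  `A` (`sum_eq_sum_of_surjective_of_determined`): they satisfy a linear relation modulo constants.

Thus a basis of `S` in `M` is sent to a basis of the span of the image of `S`, and ranks agree with
dimensions.
-/

namespace EntropicMatroid

/-! ### Extremal cases of entropy inequalities -/

lemma sum_toReal_eq_one {Ω : Type*} [Fintype Ω] (p : PMF Ω) : ∑ x, (p x).toReal = 1 := by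
  rw [← ENNReal.toReal_sum fun x _ => p.apply_ne_top x, ← tsum_fintype (L := .unconditional _),
    PMF.tsum_coe p, ENNReal.toReal_one]

lemma toReal_pos_iff_mem_support {Ω : Type*} (p : PMF Ω) (x : Ω) :
    0 < (p x).toReal ↔ x ∈ p.support := by
  rw [ENNReal.toReal_pos_iff, p.apply_pos_iff, and_iff_left (p.apply_ne_top x).lt_top]

lemma entropy_mul_log {Ω : Type*} [Fintype Ω] {b : ℝ} (hb : 1 < b) (p : PMF Ω) :
    entropy b p * Real.log b = -∑ x, (p x).toReal * Real.log (p x).toReal := by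
  have hlog : Real.log b ≠ 0 := (Real.log_pos hb).ne'
  rw [entropy, neg_mul, Finset.sum_mul]
  congr 1
  refine Finset.sum_congr rfl fun x _ => ?_
  rw [Real.logb, mul_assoc, div_mul_cancel₀ _ hlog]

/-- A distribution of maximal entropy has full support: by `log t ≤ t - 1`, the entropy to
base `e` falls short of `log |Ω|` by at least the proportion of points of `Ω` outside the
support. -/
lemma mem_support_of_entropy_eq_logb_card {Ω : Type*} [Fintype Ω] {b : ℝ} (hb : 1 < b) (p : PMF Ω)
    (hp : entropy b p = Real.logb b (Fintype.card Ω)) (x : Ω) : x ∈ p.support := by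
  classical
  by_contra hx
  have hN : (0 : ℝ) < Fintype.card Ω := by
    exact_mod_cast Fintype.card_pos_iff.2 ⟨x⟩
  have hsum : -∑ y, (p y).toReal * Real.log (p y).toReal = Real.log (Fintype.card Ω) := by
    rw [← entropy_mul_log hb, hp, Real.logb, div_mul_cancel₀ _ (Real.log_pos hb).ne']
  have hzero : (p x).toReal = 0 :=
    le_antisymm (not_lt.1 fun h => hx ((toReal_pos_iff_mem_support p x).1 h)) ENNReal.toReal_nonneg
  have key : ∑ y, (-((p y).toReal * Real.log (p y).toReal)
        - (p y).toReal * Real.log (Fintype.card Ω) + (p y).toReal)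
      < ∑ _y : Ω, (Fintype.card Ω : ℝ)⁻¹ := by
    refine Finset.sum_lt_sum (fun y _ => ?_) ⟨x, Finset.mem_univ x, by
      rw [hzero]
      simp [Fintype.card_pos_iff.2 ⟨x⟩]⟩
    rcases (ENNReal.toReal_nonneg : 0 ≤ (p y).toReal).eq_or_lt with h | h
    · rw [← h]
      simp
    · have hlog := Real.log_le_sub_one_of_pos (inv_pos.2 (mul_pos h hN))
      rw [Real.log_inv, Real.log_mul h.ne' hN.ne'] at hlog
      have hmul := mul_le_mul_of_nonneg_left hlog h.le
      have hcancel : (p y).toReal * ((p y).toReal * (Fintype.card Ω : ℝ))⁻¹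
          = (Fintype.card Ω : ℝ)⁻¹ := by
        field_simp
      rw [mul_sub, hcancel] at hmul
      linarith
  rw [Finset.sum_add_distrib, Finset.sum_sub_distrib, Finset.sum_neg_distrib, hsum,
    ← Finset.sum_mul, sum_toReal_eq_one, Finset.sum_const, Finset.card_univ, nsmul_eq_mul,
    mul_inv_cancel₀ hN.ne'] at key
  linarith

lemma toReal_map_apply {Ω Ω' : Type*} [Fintype Ω] [DecidableEq Ω'] (p : PMF Ω) (π : Ω → Ω')
    (z : Ω') : (p.map π z).toReal = ∑ x with π x = z, (p x).toReal := by
  rw [PMF.map_apply, tsum_fintype, ENNReal.toReal_sum, Finset.sum_filter]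
  · refine Finset.sum_congr rfl fun x _ => ?_
    by_cases h : π x = z
    · simp [h]
    · simp [h, Ne.symm h]
  · intro x _
    split_ifs
    exacts [p.apply_ne_top x, ENNReal.zero_ne_top]

/-- If a function of a random variable has the same entropy as the variable, then it determines the
variable: the entropy lost is the sum of the nonnegative terms
`p x * (log (p.map π (π x)) - log (p x))`, so that `p.map π (π x) = p x` on the support, and the
fibre through `x` contains no other point of the support. -/
lemma injOn_support_of_entropy_map_eq {Ω Ω' : Type*} [Fintype Ω] [Fintype Ω'] {b : ℝ} (hb : 1 < b)
    (p : PMF Ω) (π : Ω → Ω') (h : entropy b (p.map π) = entropy b p) :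
    Set.InjOn π p.support := by
  classical
  have hmap : ∑ z, (p.map π z).toReal * Real.log (p.map π z).toReal
      = ∑ x, (p x).toReal * Real.log (p.map π (π x)).toReal := by
    rw [← Finset.sum_fiberwise Finset.univ π]
    refine Finset.sum_congr rfl fun z _ => ?_
    nth_rw 1 [toReal_map_apply]
    rw [Finset.sum_mul]
    refine Finset.sum_congr rfl fun x hx => ?_
    rw [(Finset.mem_filter.1 hx).2]
  have hle : ∀ x, (p x).toReal ≤ (p.map π (π x)).toReal := fun x => by
    rw [toReal_map_apply]
    exact Finset.single_le_sum (f := fun x => (p x).toReal)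
      (fun _ _ => ENNReal.toReal_nonneg) (by simp)
  have hnonneg : ∀ x ∈ Finset.univ, 0 ≤ (p x).toReal * Real.log (p.map π (π x)).toReal
      - (p x).toReal * Real.log (p x).toReal := fun x _ => by
    rcases (ENNReal.toReal_nonneg : 0 ≤ (p x).toReal).eq_or_lt with h0 | h0
    · simp [← h0]
    · exact sub_nonneg.2 (mul_le_mul_of_nonneg_left (Real.log_le_log h0 (hle x)) h0.le)
  have hsum : ∑ x, ((p x).toReal * Real.log (p.map π (π x)).toReal
      - (p x).toReal * Real.log (p x).toReal) = 0 := by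
    have h1 := entropy_mul_log hb (p.map π)
    rw [h, entropy_mul_log hb p, hmap] at h1
    rw [Finset.sum_sub_distrib]
    linarith
  have hzero := (Finset.sum_eq_zero_iff_of_nonneg hnonneg).1 hsum
  intro x hx y hy hxy
  by_contra hne
  have hx0 := (toReal_pos_iff_mem_support p x).2 hx
  have hy0 := (toReal_pos_iff_mem_support p y).2 hy
  have heq : (p.map π (π x)).toReal = (p x).toReal := by
    have h1 := sub_eq_zero.1 (hzero x (Finset.mem_univ x))
    exact Real.log_injOn_pos (hx0.trans_le (hle x)) hx0 (mul_left_cancel₀ hx0.ne' h1)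
  have hpair : (p x).toReal + (p y).toReal ≤ (p.map π (π x)).toReal := by
    rw [toReal_map_apply, ← Finset.sum_pair (f := fun x => (p x).toReal) hne]
    refine Finset.sum_le_sum_of_subset_of_nonneg ?_ fun _ _ _ => ENNReal.toReal_nonneg
    intro w hw
    rcases Finset.mem_insert.1 hw with rfl | hw
    · simp
    · simp [Finset.mem_singleton.1 hw, hxy]
  linarith

/-! ### Parity -/

/-- If, for each `f ∈ C`, the points of `A` take all values on `C \ {f}` and these values determine
the coordinate `f`, then the coordinates in `C` have the same sum at all points of `A`. -/
lemma sum_eq_sum_of_surjective_of_determined {ι : Type*} [DecidableEq ι] (A : Set (ι → ZMod 2))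
    (C : Finset ι)
    (hsurj : ∀ f ∈ C, ∀ w : ι → ZMod 2, ∃ z ∈ A, ∀ i ∈ C.erase f, z i = w i)
    (hdet : ∀ f ∈ C, ∀ x ∈ A, ∀ y ∈ A, (∀ i ∈ C.erase f, x i = y i) → x f = y f)
    {x y : ι → ZMod 2} (hx : x ∈ A) (hy : y ∈ A) : ∑ i ∈ C, x i = ∑ i ∈ C, y i := by
  -- Induct on the Hamming distance of `x` and `y` on `C`.
  induction hn : (C.filter fun i => x i ≠ y i).card using Nat.strong_induction_on generalizing x with
  | _ n ih =>
    by_cases hxy : ∀ i ∈ C, x i = y i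
    · exact Finset.sum_congr rfl hxy
    push Not at hxy
    obtain ⟨f, hf, hfne⟩ := hxy
    obtain ⟨g, hg, hgne⟩ : ∃ g ∈ C.erase f, x g ≠ y g := by
      by_contra! h
      exact hfne (hdet f hf x hx y hy h)
    obtain ⟨hgf, hgC⟩ := Finset.mem_erase.1 hg
    -- Move `x` to a point `z` of `A` that agrees with `y` at `f` and with `x` off `f` and `g`.
    obtain ⟨z, hz, hzw⟩ := hsurj g hgC (Function.update x f (y f))
    have hzf : z f = y f := by
      simpa using hzw f (Finset.mem_erase.2 ⟨hgf.symm, hf⟩)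
    have hzi : ∀ i ∈ C, i ≠ f → i ≠ g → z i = x i := fun i hi hif hig => by
      simpa [hif] using hzw i (Finset.mem_erase.2 ⟨hig, hi⟩)
    have hzg : z g ≠ x g := fun h => by
      refine hfne ?_
      rw [← hzf]
      refine hdet f hf x hx z hz fun i hi => ?_
      obtain ⟨hif, hiC⟩ := Finset.mem_erase.1 hi
      by_cases hig : i = g
      · rw [hig, h]
      · exact (hzi i hiC hif hig).symm
    have hzgy : z g = y g := by
      generalize z g = a at *; generalize x g = b at *; generalize y g = c at *
      revert a b c; decide
    have hflip : x f + x g = z f + z g := by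
      rw [hzf, hzgy]
      generalize x f = a at *; generalize x g = b at *
      generalize y f = c at *; generalize y g = d at *
      clear * - hfne hgne
      revert a b c d; decide
    have hsum : ∑ i ∈ C, x i = ∑ i ∈ C, z i := by
      rw [← Finset.add_sum_erase C x hf, ← Finset.add_sum_erase C z hf,
        ← Finset.add_sum_erase _ x hg, ← Finset.add_sum_erase _ z hg, ← add_assoc, ← add_assoc,
        hflip]
      congr 1
      refine Finset.sum_congr rfl fun i hi => ?_
      obtain ⟨hig, hi⟩ := Finset.mem_erase.1 hi
      obtain ⟨hif, hiC⟩ := Finset.mem_erase.1 hi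
      exact (hzi i hiC hif hig).symm
    rw [hsum]
    refine ih _ ?_ hz rfl
    rw [← hn]
    refine Finset.card_lt_card (Finset.ssubset_iff_of_subset ?_ |>.2
      ⟨f, by simp [hf, hfne], by simp [hzf]⟩)
    intro i hi
    obtain ⟨hiC, hiy⟩ := Finset.mem_filter.1 hi
    have hif : i ≠ f := by rintro rfl; exact hiy hzf
    have hig : i ≠ g := by rintro rfl; exact hiy hzgy
    exact Finset.mem_filter.2 ⟨hiC, by rwa [← hzi i hiC hif hig]⟩

/-! ### Representations of matroids -/

/-- A map from the ground set of a matroid to a vector space computes ranks as soon as it sends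
independent sets to linearly independent families and the vectors of each circuit add up to `0`:
it then sends a basis of `S` to a basis of the span of the
image of `S`. -/
lemma rank_eq_finrank_span {ι V : Type*} [Finite ι] [AddCommGroup V] [Module (ZMod 2) V]
    (N : Matroid ι) (hE : N.E = Set.univ) (f : ι → V)
    (hindep : ∀ I : Finset ι, N.Indep I → LinearIndepOn (ZMod 2) f (I : Set ι))
    (hcircuit : ∀ C : Finset ι, N.IsCircuit C → ∑ i ∈ C, f i = 0) (S : Set ι) :
    rank N S = Module.finrank (ZMod 2) (Submodule.span (ZMod 2) (f '' S)) := by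
  classical
  obtain ⟨I, hI⟩ := N.exists_isBasis S (by simp [hE])
  have hspan : Submodule.span (ZMod 2) (f '' S) = Submodule.span (ZMod 2) (f '' I) := by
    refine le_antisymm (Submodule.span_le.2 ?_) (Submodule.span_mono (Set.image_mono hI.subset))
    rintro _ ⟨e, he, rfl⟩
    by_cases heI : e ∈ I
    · exact Submodule.subset_span ⟨e, heI, rfl⟩
    -- The relation on the fundamental circuit of `e` expresses `f e` in the vectors of `I`.
    have hC := hI.indep.fundCircuit_isCircuit (hI.subset_closure he) heI
    obtain ⟨C, hCeq⟩ := (Set.toFinite (N.fundCircuit e I)).exists_finset_coe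
    rw [← hCeq] at hC
    have heC : e ∈ C := by
      rw [← Finset.mem_coe, hCeq]
      exact N.mem_fundCircuit e I
    have hrel := hcircuit C hC
    rw [← Finset.add_sum_erase C f heC] at hrel
    rw [eq_neg_of_add_eq_zero_left hrel]
    refine Submodule.neg_mem _ (Submodule.sum_mem _ fun i hi => Submodule.subset_span ⟨i, ?_, rfl⟩)
    obtain ⟨hie, hiC⟩ := Finset.mem_erase.1 hi
    have hiins : i ∈ insert e I := by
      apply N.fundCircuit_subset_insert e I
      rw [← hCeq]
      exact hiC
    exact hiins.resolve_left hie
  obtain ⟨J, rfl⟩ := (Set.toFinite I).exists_finset_coe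
  have hlin := hindep J hI.indep
  rw [hspan, rank, ← hI.encard_eq_eRk, Set.encard_coe_eq_coe_finsetCard, ENat.toNat_natCast,
    Set.image_eq_range, finrank_span_eq_card hlin.linearIndependent]
  simp

/-! ### The support of an entropic distribution -/

/-- The points of the support of `μ` take all values on a set of coordinates whose marginal has
maximal entropy. -/
lemma exists_mem_support_eqOn {ι : Type*} [DecidableEq ι] (μ : PMF (ι → Fin 2)) (S : Finset ι)
    (h : entropy 2 (marginal μ S) = S.card) (w : ι → Fin 2) :
    ∃ z ∈ μ.support, ∀ i ∈ S, z i = w i := by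
  have hcard : entropy 2 (marginal μ S) = Real.logb 2 (Fintype.card (S → Fin 2)) := by
    rw [h, Fintype.card_fun, Fintype.card_fin, Fintype.card_coe, Nat.cast_pow, Nat.cast_ofNat,
      Real.logb_pow, Real.logb_self_eq_one one_lt_two, mul_one]
  have hw := mem_support_of_entropy_eq_logb_card one_lt_two _ hcard fun i : S => w i
  rw [marginal, PMF.mem_support_map_iff] at hw
  obtain ⟨z, hz, hzw⟩ := hw
  exact ⟨z, hz, fun i hi => congrFun hzw ⟨i, hi⟩⟩

/-- If the marginals of `μ` on `T ⊆ S` have the same entropy, then on the support of `μ` the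
coordinates in `T` determine those in `S`. -/
lemma eqOn_of_entropy_marginal_eq {ι : Type*} [DecidableEq ι] (μ : PMF (ι → Fin 2))
    {S T : Finset ι} (hTS : T ⊆ S) (h : entropy 2 (marginal μ T) = entropy 2 (marginal μ S))
    {x y : ι → Fin 2} (hx : x ∈ μ.support) (hy : y ∈ μ.support) (hxy : ∀ i ∈ T, x i = y i) :
    ∀ i ∈ S, x i = y i := by
  have hmap : marginal μ T
      = (marginal μ S).map fun (u : S → Fin 2) (i : T) => u ⟨i, hTS i.2⟩ := by
    rw [marginal, marginal, PMF.map_comp]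
    rfl
  rw [hmap] at h
  have hinj := injOn_support_of_entropy_map_eq one_lt_two _ _ h
  have hmem : ∀ z ∈ μ.support, (fun i : S => z i) ∈ (marginal μ S).support := fun z hz => by
    rw [marginal, PMF.mem_support_map_iff]
    exact ⟨z, hz, rfl⟩
  have heq := hinj (hmem x hx) (hmem y hy) (funext fun i => hxy i i.2)
  exact fun i hi => congrFun heq ⟨i, hi⟩

/-- A matroid on a finite type whose ranks are binary entropies is binary. -/
lemma exists_representation_of_rank_eq_entropy {ι : Type*} [Finite ι] [DecidableEq ι]
    (N : Matroid ι) (hE : N.E = Set.univ) (μ : PMF (ι → Fin 2))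
    (hμ : ∀ S : Finset ι, (rank N (S : Set ι) : ℝ) = entropy 2 (marginal μ S)) :
    ∃ (n : ℕ) (f : ι → Fin n → ZMod 2), ∀ S : Set ι,
      rank N S = Module.finrank (ZMod 2) (Submodule.span (ZMod 2) (f '' S)) := by
  obtain ⟨n, φ, -, hφ⟩ := (Set.toFinite μ.support).fin_param
  obtain ⟨x₀, hx₀⟩ := μ.support_nonempty
  -- `Fin 2` and `ZMod 2` are definitionally equal, so the coordinates can be read in `ZMod 2`.
  let coord : (ι → Fin 2) → ι → ZMod 2 := fun x => x
  have hsurj : ∀ I : Finset ι, N.Indep I → ∀ w : ι → Fin 2,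
      ∃ z ∈ μ.support, ∀ i ∈ I, z i = w i := fun I hI => by
    refine exists_mem_support_eqOn μ I ?_
    rw [← hμ, rank, hI.eRk_eq_encard, Set.encard_coe_eq_coe_finsetCard, ENat.toNat_natCast]
  -- The vector of `e` is the `e`-th coordinate function on the support, which `φ` enumerates by
  -- `Fin n`, normalised to vanish at `x₀`.
  refine ⟨n, fun i k => coord (φ k) i - coord x₀ i,
    rank_eq_finrank_span N hE _ (fun I hI => ?_) fun C hC => ?_⟩
  · rw [linearIndepOn_finset_iff]
    intro c hc j hj
    -- Evaluate the relation at a point of the support that differs from `x₀` only at `j` on `I`.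
    obtain ⟨z, hz, hzw⟩ := hsurj I hI (Function.update x₀ j (x₀ j + 1))
    obtain ⟨k, rfl⟩ : z ∈ Set.range φ := hφ ▸ hz
    have hk := congrFun hc k
    rw [Finset.sum_apply, Finset.sum_eq_single_of_mem j hj] at hk
    · have hj1 : coord (φ k) j = coord x₀ j + 1 := by
        have := hzw j hj
        rw [Function.update_self] at this
        exact this
      simpa [hj1] using hk
    · intro i hi hij
      have hi1 : coord (φ k) i = coord x₀ i := by
        have := hzw i hi
        rw [Function.update_of_ne hij] at this
        exact this
      simp [hi1]
  · ext k
    have hk : φ k ∈ μ.support := hφ ▸ Set.mem_range_self k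
    rw [Finset.sum_apply, Finset.sum_sub_distrib, Pi.zero_apply, sub_eq_zero]
    refine sum_eq_sum_of_surjective_of_determined (ι := ι) μ.support C (fun f hf => ?_)
      (fun f hf x hx y hy hxy => ?_) hk hx₀
    · refine hsurj (C.erase f) ?_
      rw [Finset.coe_erase]
      exact hC.sdiff_singleton_indep hf
    · refine eqOn_of_entropy_marginal_eq μ (C.erase_subset f) ?_ hx hy hxy f hf
      rw [← hμ, ← hμ, rank, rank, Finset.coe_erase, (hC.sdiff_singleton_isBasis hf).eRk_eq_eRk]

end EntropicMatroid

theorem mainTheorem2 {α : Type*} (M : Matroid α) [M.Finite]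
    (hM : EntropicMatroid.IsEntropic 2 M) : EntropicMatroid.IsBinary M := by
  obtain ⟨μ, hμ⟩ := hM
  classical
  have : Finite M.E := M.ground_finite.to_subtype
  -- Pass to the copy of `M` on the subtype `M.E`.
  have hrank (S : Set M.E) : EntropicMatroid.rank (M.comap ((↑) : M.E → α)) S
      = EntropicMatroid.rank M ((fun e : M.E => (e : α)) '' S) := by
    rw [EntropicMatroid.rank, EntropicMatroid.rank, Matroid.eRk_comap]
  obtain ⟨n, f, hf⟩ := EntropicMatroid.exists_representation_of_rank_eq_entropy
    (M.comap ((↑) : M.E → α)) (by simp) μ fun S => by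
      rw [hrank]
      convert hμ S
      norm_num
  exact ⟨Fin n → ZMod 2, inferInstance, inferInstance, f, fun S => by rw [← hrank, hf]⟩
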